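/- Consider $N$ agents and $S$ coupling constraints. For $i\in\{1,\dots,N\}$ let $c_i\in\mathbb{R}^{n_i}$, $A_i\in\mathbb{R}^{S\times n_i}$, and let $X_i=\{x\in\mathbb{Z}^{Z_i}\times\mathbb{R}^{R_i} : D_i x\preceq d_i\}$ (with $Z_i+R_i=n_i$) be a nonempty compact mixed-integer polyhedral set; let $b,\sigma\in\mathbb{R}^S$ with $\sigma\succeq 0$ ($\preceq,\succeq$ are componentwise). The agents are the nodes of a connected undirected graph, and $\mathcal{N}_i$ is the set of neighbors of $i$. Assume that the restricted LP $$\min_{z_1,\dots,z_N}\ \sum_{i=1}^N c_i^\top z_i\quad\text{s.t.}\quad \sum_{i=1}^N A_i z_i\preceq b-\sigma,\qquad z_i\in\operatorname{conv}(X_i),\ i=1,\dots,N,\tag{LP}$$ is feasible and has a unique optimal solution. Let $Y_i$ be the set of $y_i\in\mathbb{R}^S$ for which some $z_i\in\operatorname{conv}(X_i)$ satisfies $A_i z_i\preceq y_i$, and for $y_i\in Y_i$ let $p_i(y_i)=\min\{c_i^\top z_i : A_i z_i\preceq y_i,\ z_i\in\operatorname{conv}(X_i)\}$. The master problem is $$\min_{y_1,\dots,y_N}\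 \sum_{i=1}^N p_i(y_i)\quad\text{s.t.}\quad \sum_{i=1}^N y_i=b-\sigma,\qquad y_i\in Y_i,\ i=1,\dots,N.$$ For $M>0$ and step sizes $\alpha^t$, the distributed algorithm generates sequences as follows: at each time $t\ge 0$ every agent $i$ takes a primal-dual optimal solution pair $((z_i^t,v_i^t),\mu_i^t)$ of $$\min_{z_i,v_i}\ c_i^\top z_i+Mv_i\quad\text{s.t.}\quad A_i z_i\preceq y_i^t+v_i\mathbf{1},\qquad z_i\in\operatorname{conv}(X_i),\ v_i\ge 0,$$ where $\mu_i^t\succeq 0$ is the multiplier of the constraint $A_i z_i\preceq y_i^t+v_i\mathbf{1}$ (that is, $\mu_i^t$ maximizes over $\mu\succeq 0$ the dual function $\inf_{z_i\in\operatorname{conv}(X_i),\,v_i\ge 0}\; c_i^\top z_i+Mv_i+\mu^\top(A_i z_i-y_i^t-v_i\mathbf{1})$), and then sets $$y_i^{t+1}=y_i^t+\alpha^t\sum_{j\in\mathcal{N}_i}(\mu_i^t-\mu_j^t).$$ Then there is $M_0>0$ such that for every $M\ge M_0$, every step-size sequence with $\alpha^t\ge 0$, $\sum_{t=0}^\infty\alpha^t=\infty$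 and $\sum_{t=0}^\infty(\alpha^t)^2<\infty$, every initialization with $\sum_{i=1}^N y_i^0=b-\sigma$, and all sequences generated by the algorithm from these data: 1. $\sum_{i=1}^N y_i^t=b-\sigma$ for all $t\ge 0$; 2. there is an optimal solution $(y_1^\star,\dots,y_N^\star)$ of the master problem with $\lim_{t\to\infty}\|y_i^t-y_i^\star\|=0$ for all $i$; 3. every limit point $(z_1^\infty,\dots,z_N^\infty)$ of the sequence $\{(z_1^t,\dots,z_N^t)\}_{t\ge 0}$ is an optimal solution of (LP), and $\sum_{i=1}^N c_i^\top z_i^\infty$ equals the optimal cost of (LP). -/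

import Mathlib

open Filter Topology

/-- Data of a constraint-coupled mixed-integer linear program with `N` agents and `S` coupling
constraints. Agent `i` has `intDim i` integer and `realDim i` real variables, cost vector `c i`,
coupling matrix `A i`, and local linear constraints `D i x ≤ d i` (`numCons i` of them).
The total resource is `b`. -/
structure CoupledMILP (N S : ℕ) where
  intDim : Fin N → ℕ
  realDim : Fin N → ℕ
  numCons : Fin N → ℕ
  c : ∀ i, Fin (intDim i) ⊕ Fin (realDim i) → ℝ
  A : ∀ i, Matrix (Fin S) (Fin (intDim i) ⊕ Fin (realDim i)) ℝ
  b : Fin S → ℝ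
  D : ∀ i, Matrix (Fin (numCons i)) (Fin (intDim i) ⊕ Fin (realDim i)) ℝ
  d : ∀ i, Fin (numCons i) → ℝ

namespace CoupledMILP

variable {N S : ℕ} (P : CoupledMILP N S)

/-- The decision space `ℝ^{n_i}` of agent `i`, with `n_i = intDim i + realDim i`. -/
abbrev Var (i : Fin N) : Type := Fin (P.intDim i) ⊕ Fin (P.realDim i) → ℝ

/-- The mixed-integer polyhedral local constraint set `X_i`. -/
def X (i : Fin N) : Set (P.Var i) :=
  {x | (∀ k : Fin (P.intDim i), ∃ m : ℤ, x (Sum.inl k) = (m : ℝ)) ∧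
    (P.D i).mulVec x ≤ P.d i}

/-- The convex hull `conv(X_i)`. -/
def convX (i : Fin N) : Set (P.Var i) := convexHull ℝ (P.X i)

/-- The total cost `∑ i, c_iᵀ z_i`. -/
def cost (z : ∀ i, P.Var i) : ℝ := ∑ i, P.c i ⬝ᵥ z i

/-- Feasible set of the restricted LP with restriction `σ`. -/
def lpFeasible (σ : Fin S → ℝ) : Set (∀ i, P.Var i) :=
  {z | ∑ i, (P.A i).mulVec (z i) ≤ P.b - σ ∧ ∀ i, z i ∈ P.convX i}

/-- `z` is an optimal solution of the restricted LP. -/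
def IsLPOptimal (σ : Fin S → ℝ) (z : ∀ i, P.Var i) : Prop :=
  z ∈ P.lpFeasible σ ∧ ∀ z' ∈ P.lpFeasible σ, P.cost z ≤ P.cost z'

/-- The optimal cost of the restricted LP. -/
noncomputable def lpValue (σ : Fin S → ℝ) : ℝ := sInf (P.cost '' P.lpFeasible σ)

/-- Feasible set of the subproblem of agent `i` with allocation `y`. -/
def subFeasible (i : Fin N) (y : Fin S → ℝ) : Set (P.Var i) :=
  {z | (P.A i).mulVec z ≤ y ∧ z ∈ P.convX i}

/-- The set `Y_i` of allocations for which the subproblem of agent `i` is feasible. -/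
def Y (i : Fin N) : Set (Fin S → ℝ) := {y | (P.subFeasible i y).Nonempty}

/-- The optimal cost `p_i(y)` of the subproblem of agent `i`. It is only used for `y ∈ Y_i`; there
the infimum is over a nonempty set, bounded below when `X_i` is compact. -/
noncomputable def p (i : Fin N) (y : Fin S → ℝ) : ℝ :=
  sInf ((fun z => P.c i ⬝ᵥ z) '' P.subFeasible i y)

/-- Feasible set of the master problem. -/
def masterFeasible (σ : Fin S → ℝ) : Set (Fin N → Fin S → ℝ) :=
  {y | ∑ i, y i = P.b - σ ∧ ∀ i, y i ∈ P.Y i}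

/-- `y` is an optimal solution of the master problem. -/
def IsMasterOptimal (σ : Fin S → ℝ) (y : Fin N → Fin S → ℝ) : Prop :=
  y ∈ P.masterFeasible σ ∧
    ∀ y' ∈ P.masterFeasible σ, ∑ i, P.p i (y i) ≤ ∑ i, P.p i (y' i)

/-- Feasible set of the relaxed local LP of agent `i` with allocation `y`, in the variables
`(z, v)`. -/
def relaxedFeasible (i : Fin N) (y : Fin S → ℝ) : Set (P.Var i × ℝ) :=
  {w | (∀ s, (P.A i).mulVec w.1 s ≤ y s + w.2) ∧ w.1 ∈ P.convX i ∧ 0 ≤ w.2}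

/-- `(z, v)` is an optimal solution of the relaxed local LP with penalty `M`. -/
def IsRelaxedOptimal (M : ℝ) (i : Fin N) (y : Fin S → ℝ) (z : P.Var i) (v : ℝ) : Prop :=
  (z, v) ∈ P.relaxedFeasible i y ∧
    ∀ w ∈ P.relaxedFeasible i y, P.c i ⬝ᵥ z + M * v ≤ P.c i ⬝ᵥ w.1 + M * w.2

/-- The Lagrangian of the relaxed local LP, with multiplier `μ` for the coupling-type constraint
`A_i z ≤ y + v 1`. -/
def lagrangian (M : ℝ) (i : Fin N) (y : Fin S → ℝ) (z : P.Var i) (v : ℝ) (μ : Fin S → ℝ) : ℝ :=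
  P.c i ⬝ᵥ z + M * v + ∑ s, μ s * ((P.A i).mulVec z s - (y s + v))

/-- The dual function of the relaxed local LP: the infimum (possibly `-∞`) of the Lagrangian over
`z ∈ conv(X_i)` and `v ≥ 0`. -/
noncomputable def dualFunction (M : ℝ) (i : Fin N) (y μ : Fin S → ℝ) : EReal :=
  ⨅ (z : P.Var i) (_ : z ∈ P.convX i) (v : ℝ) (_ : 0 ≤ v), (P.lagrangian M i y z v μ : EReal)

/-- `μ` is a dual optimal solution of the relaxed local LP. -/
def IsDualOptimal (M : ℝ) (i : Fin N) (y μ : Fin S → ℝ) : Prop :=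
  0 ≤ μ ∧ ∀ μ' : Fin S → ℝ, 0 ≤ μ' → P.dualFunction M i y μ' ≤ P.dualFunction M i y μ

/-- The sequences `y, z, v, μ` are generated by the distributed algorithm over the graph `G` with
penalty `M` and step sizes `α`: at each time every agent takes some primal-dual optimal solution
pair of its relaxed local LP, then updates its allocation using the multipliers of its
neighbors. -/
structure IsAlgorithmRun (G : SimpleGraph (Fin N)) [DecidableRel G.Adj] (M : ℝ) (α : ℕ → ℝ)
    (y : ℕ → Fin N → Fin S → ℝ) (z : ℕ → ∀ i, P.Var i) (v : ℕ → Fin N → ℝ)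
    (μ : ℕ → Fin N → Fin S → ℝ) : Prop where
  primal : ∀ t i, P.IsRelaxedOptimal M i (y t i) (z t i) (v t i)
  dual : ∀ t i, P.IsDualOptimal M i (y t i) (μ t i)
  update : ∀ t i, y (t + 1) i = y t i + α t • ∑ j ∈ G.neighborFinset i, (μ t i - μ t j)

end CoupledMILP

/-- Diminishing step sizes: nonnegative, with infinite sum, square summable. -/
structure IsDiminishingStepSize (α : ℕ → ℝ) : Prop where
  nonneg : ∀ t, 0 ≤ α t
  sum_eq_top : Tendsto (fun T => ∑ t ∈ Finset.range T, α t) atTop atTop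
  sq_summable : Summable fun t => α t ^ 2

/-! Let `f y` be the sum of the optimal values of the relaxed local LPs. It is Lipschitz, and minus
a dual optimal solution is a subgradient of each summand (`IsDualOptimal.dotProduct_sub_le`). The
update adds `α L μ`, with `L` the graph Laplacian, so it is a subgradient step for `f` on the affine
space of fixed total resource, in the metric given by an inverse `R` of `L` on zero-sum vectors. In
that metric the squared distance to a minimizer changes by a term at most `-2 α (f y - min f)` plus
`O(α ^ 2)`, because `L` cancels against `R` and the multipliers are bounded by `M`. The diminishing
steps then force convergence to one minimizer (`exists_tendsto_minimizer`).

Minimizers of `f` are tied to the LP by exact penalization: once `M` exceeds the sum of an LP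
multiplier by one, the total violation `∑ v` is at most `f y` minus the LP optimum. Hence the
minimum of `f` is the LP optimum, minimizers are master optimal, and along a run the violations
vanish while the costs converge to the LP optimum. Limit points of `z` are therefore feasible and
optimal. Duality rests on `farkas` and on `conv(X_i)` being a polytope. -/

/-! ### Linear programming duality and polytopes. -/

/-- **Farkas' lemma** for finitely many linear functionals on a real vector space. -/
theorem farkas {ι V : Type*} [AddCommGroup V] [Module ℝ V] (s : Finset ι) :
    ∀ (a : ι → V →ₗ[ℝ] ℝ) (b : V →ₗ[ℝ] ℝ), (∀ x, (∀ i ∈ s, a i x ≤ 0) → b x ≤ 0) →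
      ∃ l : ι → ℝ, (∀ i, 0 ≤ l i) ∧ b = ∑ i ∈ s, l i • a i := by
  classical
  induction s using Finset.induction_on with
  | empty =>
    intro a b h
    refine ⟨0, fun _ => le_rfl, ?_⟩
    ext x
    have h1 := h x (by simp)
    have h2 := h (-x) (by simp)
    simp only [map_neg] at h2
    simp only [Finset.sum_empty, LinearMap.zero_apply]
    linarith
  | insert j s hj ih =>
    intro a b h
    by_cases hs : ∀ x, (∀ i ∈ s, a i x ≤ 0) → b x ≤ 0
    · obtain ⟨l, hl, rfl⟩ := ih a b hs
      refine ⟨fun i => if i = j then 0 else l i, fun i => by dsimp only; split_ifs <;> simp [hl], ?_⟩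
      rw [Finset.sum_insert hj]
      dsimp only
      rw [if_pos rfl, zero_smul, zero_add]
      refine Finset.sum_congr rfl fun i hi => ?_
      rw [if_neg (by rintro rfl; exact hj hi)]
    · push Not at hs
      obtain ⟨x', hx', hb'⟩ := hs
      have hpos : 0 < a j x' := by
        by_contra hc
        refine absurd (h x' fun i hi => ?_) (not_le.2 hb')
        rcases Finset.mem_insert.1 hi with rfl | hi
        · exact not_lt.1 hc
        · exact hx' i hi
      set e := (a j x')⁻¹ • x' with he
      have hje : a j e = 1 := by simp [he, hpos.ne']
      have hae : ∀ i ∈ s, a i e ≤ 0 := fun i hi => by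
        simpa [he] using mul_nonpos_of_nonneg_of_nonpos (inv_nonneg.2 hpos.le) (hx' i hi)
      have hbe : 0 ≤ b e := by
        simpa [he] using mul_nonneg (inv_nonneg.2 hpos.le) hb'.le
      -- Composing with the projection `x ↦ x - a j x • e` onto the kernel of `a j` removes the
      -- constraint `j`, so the induction hypothesis applies to the composed functionals.
      obtain ⟨l, hl, hbl⟩ := ih (fun i => a i - a i e • a j) (b - b e • a j) (by
        intro x hx
        have := h (x - a j x • e) (by
          intro i hi
          rcases Finset.mem_insert.1 hi with rfl | hi
          · simp [hje]
          · have := hx i hi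
            simp only [LinearMap.sub_apply, LinearMap.smul_apply, smul_eq_mul] at this
            simp only [map_sub, map_smul, smul_eq_mul]
            linarith)
        simp only [map_sub, map_smul, smul_eq_mul] at this
        simp only [LinearMap.sub_apply, LinearMap.smul_apply, smul_eq_mul]
        linarith)
      refine ⟨fun i => if i = j then b e - ∑ i ∈ s, l i * a i e else l i, fun i => ?_, ?_⟩
      · dsimp only
        split_ifs
        · have : ∑ i ∈ s, l i * a i e ≤ 0 :=
            Finset.sum_nonpos fun i hi => mul_nonpos_of_nonneg_of_nonpos (hl i) (hae i hi)
          linarith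
        · exact hl i
      · rw [Finset.sum_insert hj]
        dsimp only
        rw [if_pos rfl,
          Finset.sum_congr rfl (g := fun i => l i • a i) fun i hi => by
            rw [if_neg (by rintro rfl; exact hj hi)]]
        simp only [smul_sub, Finset.sum_sub_distrib, smul_smul, ← Finset.sum_smul] at hbl
        ext x
        have := LinearMap.congr_fun hbl x
        simp only [LinearMap.sub_apply, LinearMap.add_apply, LinearMap.smul_apply,
          LinearMap.sum_apply, smul_eq_mul] at this ⊢
        linarith

/-- Existence of Lagrange multipliers for a linear program over a polytope, with one additional
nonnegative scalar variable. -/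
theorem exists_multiplier {E : Type*} [AddCommGroup E] [Module ℝ E] {S : ℕ} {F : Set E}
    (hF : F.Finite) (k : E →ₗ[ℝ] ℝ) (a : E →ₗ[ℝ] (Fin S → ℝ)) (β r : Fin S → ℝ) {m : ℝ}
    (hm : 0 ≤ m) (κ : ℝ)
    (h : ∀ z ∈ convexHull ℝ F, ∀ v : ℝ, 0 ≤ v → a z + v • r ≤ β → κ ≤ k z + m * v) :
    ∃ μ : Fin S → ℝ, 0 ≤ μ ∧ (∀ z ∈ convexHull ℝ F, κ ≤ k z + μ ⬝ᵥ (a z - β)) ∧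
      0 ≤ m + μ ⬝ᵥ r := by
  classical
  set T := hF.toFinset
  let pt : (Fin S → ℝ) → ℝ → ((Fin S → ℝ) × ℝ →ₗ[ℝ] ℝ) := fun u t =>
    -((dotProductBilin ℝ ℝ u).comp (LinearMap.fst ℝ _ _) + t • LinearMap.snd ℝ _ _)
  have hpt : ∀ u t x, pt u t x = -(u ⬝ᵥ x.1 + t * x.2) := fun u t x => by
    simp [pt]
  -- Homogenized dual system in `(u, t)`: one inequality per vertex, one for the scalar variable,
  -- and `u ≥ 0`. A solution with `t > 0` gives the multiplier `u / t`. If there is none, Farkas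
  -- weights on the vertices average to a feasible point of cost below `κ`.
  let g : E ⊕ Option (Fin S) → ((Fin S → ℝ) × ℝ →ₗ[ℝ] ℝ) := fun o =>
    Sum.elim (fun f => pt (a f - β) (k f - κ))
      (fun o => o.elim (pt r m) fun s => pt (Pi.single s 1) 0) o
  by_cases hc : ∀ x, (∀ i ∈ T.disjSum Finset.univ, g i x ≤ 0) → LinearMap.snd ℝ _ ℝ x ≤ 0
  · exfalso
    obtain ⟨l, hl, hs⟩ := farkas _ g _ hc
    rw [Finset.sum_disjSum, Fintype.sum_option] at hs
    have hcoef : ∀ u t, t = -(∑ f ∈ T, l (.inl f) * ((a f - β) ⬝ᵥ u + (k f - κ) * t)) -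
        l (.inr none) * (r ⬝ᵥ u + m * t) - ∑ s, l (.inr (some s)) * u s := by
      intro u t
      have := congrArg (fun φ => φ (u, t)) hs
      simp only [LinearMap.add_apply, LinearMap.sum_apply, LinearMap.smul_apply, g, Sum.elim_inl,
        Sum.elim_inr, Option.elim, hpt, smul_eq_mul, LinearMap.snd_apply, single_dotProduct,
        mul_neg, Finset.sum_neg_distrib, zero_mul, add_zero, one_mul] at this
      linarith
    have hle : ∀ s, ∑ f ∈ T, l (.inl f) * (a f s - β s) + l (.inr none) * r s ≤ 0 := by
      intro s
      have := hcoef (Pi.single s 1) 0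
      simp only [dotProduct_single, mul_one, mul_zero, add_zero, Pi.sub_apply, Pi.single_apply,
        mul_ite, Finset.sum_ite_eq', Finset.mem_univ, if_true] at this
      linarith [hl (.inr (some s))]
    have hk : ∑ f ∈ T, l (.inl f) * (k f - κ) + l (.inr none) * m = -1 := by
      have := hcoef 0 1
      simp only [dotProduct_zero, mul_one, zero_add, Pi.zero_apply, mul_zero,
        Finset.sum_const_zero, sub_zero] at this
      linarith
    set v := l (.inr none) with hv
    have hv0 : 0 ≤ v := hl _
    set Λ := ∑ f ∈ T, l (.inl f) with hΛ
    have hΛ0 : 0 ≤ Λ := Finset.sum_nonneg fun _ _ => hl _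
    rcases hΛ0.eq_or_lt with h0 | hpos
    · have hz := (Finset.sum_eq_zero_iff_of_nonneg fun f _ => hl (.inl f)).1 h0.symm
      rw [Finset.sum_eq_zero fun f hf => by rw [hz f hf, zero_mul]] at hk
      nlinarith
    · have hz : T.centerMass (fun f => l (.inl f)) id ∈ convexHull ℝ F :=
        T.centerMass_mem_convexHull (fun f _ => hl _) hpos fun f hf => by simpa [T] using hf
      have hlin : ∀ {W : Type} [AddCommGroup W] [Module ℝ W] (φ : E →ₗ[ℝ] W),
          φ (T.centerMass (fun f => l (.inl f)) id) = Λ⁻¹ • ∑ f ∈ T, l (.inl f) • φ f := by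
        intro W _ _ φ
        simp [Finset.centerMass, hΛ]
      have := h _ hz (Λ⁻¹ * v) (by positivity) (by
        intro s
        have h1 := hle s
        simp only [mul_sub, Finset.sum_sub_distrib, ← Finset.sum_mul, ← hΛ] at h1
        simp only [hlin, Pi.add_apply, Pi.smul_apply, Finset.sum_apply, smul_eq_mul]
        have : Λ⁻¹ * ∑ f ∈ T, l (.inl f) * a f s + Λ⁻¹ * v * r s
          = Λ⁻¹ * (∑ f ∈ T, l (.inl f) * a f s + v * r s) := by ring
        rw [this, inv_mul_le_iff₀ hpos]
        linarith)
      simp only [mul_sub, Finset.sum_sub_distrib, ← Finset.sum_mul, ← hΛ] at hk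
      simp only [hlin, smul_eq_mul] at this
      have h2 : Λ⁻¹ * ∑ f ∈ T, l (.inl f) * k f + m * (Λ⁻¹ * v)
          = Λ⁻¹ * (∑ f ∈ T, l (.inl f) * k f + v * m) := by ring
      rw [h2, le_inv_mul_iff₀ hpos] at this
      linarith
  · push Not at hc
    obtain ⟨⟨u, t⟩, hx, ht⟩ := hc
    simp only [LinearMap.snd_apply] at ht
    refine ⟨t⁻¹ • u, ?_, ?_, ?_⟩
    · intro s
      have := hx (.inr (some s)) (by simp)
      simp only [g, Sum.elim_inr, Option.elim, hpt, single_dotProduct, one_mul, zero_mul,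
        add_zero] at this
      have : 0 ≤ u s := by linarith
      simp only [Pi.zero_apply, Pi.smul_apply, smul_eq_mul]
      positivity
    · have hconv : Convex ℝ {z | κ ≤ k z + (t⁻¹ • u) ⬝ᵥ (a z - β)} := by
        have := convex_halfSpace_ge (𝕜 := ℝ) (f := fun z => (k + (dotProductBilin ℝ ℝ (t⁻¹ • u)).comp a) z)
          (LinearMap.isLinear _) (κ + (t⁻¹ • u) ⬝ᵥ β)
        convert this using 3 with z
        simp only [dotProduct_sub, LinearMap.add_apply, LinearMap.comp_apply,
          dotProductBilin_apply_apply]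
        constructor <;> intro h <;> linarith
      refine fun z hz => convexHull_min (fun f hf => ?_) hconv hz
      have := hx (.inl f) (by simpa [T] using hf)
      simp only [g, Sum.elim_inl, hpt] at this
      have h3 : κ - k f ≤ t⁻¹ * (u ⬝ᵥ (a f - β)) := by
        rw [le_inv_mul_iff₀ ht, dotProduct_comm]; linarith
      simp only [Set.mem_ofPred_eq, smul_dotProduct, smul_eq_mul]
      linarith
    · have := hx (.inr none) (by simp)
      simp only [g, Sum.elim_inr, Option.elim, hpt] at this
      have h3 : -m ≤ t⁻¹ * (u ⬝ᵥ r) := by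
        rw [le_inv_mul_iff₀ ht, dotProduct_comm]; linarith
      simp only [smul_dotProduct, smul_eq_mul]
      linarith

/-- A polyhedron has finitely many extreme points. -/
theorem finite_extremePoints_polyhedron {ι κ : Type*} [Fintype ι] [Fintype κ]
    (D : Matrix κ ι ℝ) (d : κ → ℝ) (J : Set ι) (m : ι → ℝ) :
    (Set.extremePoints ℝ {x : ι → ℝ | (∀ k ∈ J, x k = m k) ∧ D.mulVec x ≤ d}).Finite := by
  -- An extreme point is determined by its active rows: if `x'` has the same ones as `x`, then `x ±
  -- ε (x - x')` stays feasible for small `ε`, since inactive rows have slack.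
  refine Set.Finite.of_finite_image (f := fun x => {r | D.mulVec x r = d r}) (Set.toFinite _) ?_
  intro x hx x' hx' hxx
  have hact : ∀ r, D.mulVec x r = d r → D.mulVec x' r = d r := fun r hr =>
    (Set.ext_iff.1 hxx r).1 hr
  have hev : ∀ᶠ ε : ℝ in 𝓝 0, ∀ r, D.mulVec (x + ε • (x - x')) r ≤ d r := by
    refine eventually_all.2 fun r => ?_
    by_cases hr : D.mulVec x r = d r
    · refine Eventually.of_forall fun ε => ?_
      simp [Matrix.mulVec_add, Matrix.mulVec_smul, Matrix.mulVec_sub, hr, hact r hr]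
    · have hc : Continuous fun ε : ℝ => D.mulVec (x + ε • (x - x')) r := by
        simp only [Matrix.mulVec_add, Matrix.mulVec_smul, Pi.add_apply, Pi.smul_apply]
        fun_prop
      have hlt : D.mulVec (x + (0 : ℝ) • (x - x')) r < d r := by
        simpa using lt_of_le_of_ne (hx.1.2 r) hr
      exact (hc.continuousAt.eventually_lt continuousAt_const hlt).mono fun _ => le_of_lt
  obtain ⟨δ, hδ, hball⟩ := Metric.eventually_nhds_iff.1 hev
  have hmem : ∀ ε : ℝ, |ε| < δ →
      x + ε • (x - x') ∈ {x : ι → ℝ | (∀ k ∈ J, x k = m k) ∧ D.mulVec x ≤ d} := fun ε hε =>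
    ⟨fun k hk => by simp [hx.1.1 k hk, hx'.1.1 k hk], hball (by simpa using hε)⟩
  have h1 := hmem (δ / 2) (by rw [abs_of_pos] <;> linarith)
  have h2 := hmem (-(δ / 2)) (by rw [abs_neg, abs_of_pos] <;> linarith)
  have := hx.2 h1 h2 ⟨1 / 2, 1 / 2, by norm_num, by norm_num, by norm_num, by
    ext k; simp; ring⟩
  have h3 : (δ / 2) • (x - x') = 0 := by simpa using this
  rcases smul_eq_zero.1 h3 with h | h
  · linarith
  · exact sub_eq_zero.1 h

namespace CoupledMILP

variable {N S : ℕ} (P : CoupledMILP N S)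

/-- The convex hull of a compact mixed-integer polyhedral set is a polytope. -/
theorem exists_finite_convexHull_eq {i : Fin N} (hX : IsCompact (P.X i)) :
    ∃ F : Set (P.Var i), F.Finite ∧ P.convX i = convexHull ℝ F := by
  classical
  obtain ⟨B, hB⟩ := hX.isBounded.exists_norm_le
  -- Slice with prescribed integer coordinates. Boundedness leaves finitely many relevant slices,
  -- and each is a compact polyhedron, to which Krein–Milman applies.
  let T : (Fin (P.intDim i) → ℤ) → Set (P.Var i) := fun m =>
    {x | (∀ k ∈ Set.range Sum.inl, x k = Sum.elim (fun j => (m j : ℝ)) 0 k) ∧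
      (P.D i).mulVec x ≤ P.d i}
  have hTX : ∀ m, T m ⊆ P.X i := fun m x hx =>
    ⟨fun k => ⟨m k, hx.1 _ ⟨k, rfl⟩⟩, hx.2⟩
  have hTcl : ∀ m, IsClosed (T m) := fun m => by
    simp only [T, Set.ofPred_and, Set.ofPred_forall]
    refine IsClosed.inter (isClosed_iInter fun k => isClosed_iInter fun _ =>
      isClosed_eq (continuous_apply k) continuous_const) ?_
    exact isClosed_le (Continuous.matrix_mulVec continuous_const continuous_id) continuous_const
  have hTconv : ∀ m, Convex ℝ (T m) := fun m x hx y hy p q hp hq hpq => by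
    refine ⟨fun k hk => ?_, ?_⟩
    · simp only [Pi.add_apply, Pi.smul_apply, hx.1 k hk, hy.1 k hk, ← add_smul, hpq, one_smul]
    · intro r
      have h1 := mul_le_mul_of_nonneg_left (hx.2 r) hp
      have h2 := mul_le_mul_of_nonneg_left (hy.2 r) hq
      simp only [Matrix.mulVec_add, Matrix.mulVec_smul, Pi.add_apply, Pi.smul_apply, smul_eq_mul]
      calc _ ≤ p * P.d i r + q * P.d i r := add_le_add h1 h2
        _ = P.d i r := by rw [← add_mul, hpq, one_mul]
  let I : Set (Fin (P.intDim i) → ℤ) := Set.univ.pi fun _ => Set.Icc (-⌈B⌉) ⌈B⌉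
  refine ⟨⋃ m ∈ I, (T m).extremePoints ℝ, ?_, ?_⟩
  · exact (Set.Finite.pi fun _ => Set.finite_Icc _ _).biUnion fun m _ => finite_extremePoints_polyhedron _ _ _ _
  · refine Set.Subset.antisymm (convexHull_min (fun x hx => ?_) (convex_convexHull ℝ _))
      (convexHull_mono (Set.iUnion₂_subset fun m _ => extremePoints_subset.trans (hTX m)))
    choose m hm using hx.1
    have hmI : m ∈ I := by
      intro k _
      have h1 : |(m k : ℝ)| ≤ B := by
        rw [← hm k, ← Real.norm_eq_abs]
        exact (norm_le_pi_norm x _).trans (hB x hx)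
      have h2 := abs_le.1 (h1.trans (Int.le_ceil B))
      exact ⟨by exact_mod_cast h2.1, by exact_mod_cast h2.2⟩
    have hxT : x ∈ T m := ⟨by rintro _ ⟨k, rfl⟩; simp [hm k], hx.2⟩
    have hfin : ((T m).extremePoints ℝ).Finite := finite_extremePoints_polyhedron _ _ _ _
    have hKM := closure_convexHull_extremePoints (hX.of_isClosed_subset (hTcl m) (hTX m))
      (hTconv m)
    rw [(hfin.isClosed_convexHull ℝ).closure_eq] at hKM
    rw [← hKM] at hxT
    exact convexHull_mono (Set.subset_biUnion_of_mem (u := fun m => (T m).extremePoints ℝ) hmI) hxT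

end CoupledMILP

/-! ### Convergence of subgradient iterations. -/

/-- A nonnegative sequence that decreases by nonnegative amounts up to summable errors converges,
and the decreases are summable. -/
theorem tendsto_and_summable_of_le_sub_add {a e b : ℕ → ℝ} (ha : ∀ t, 0 ≤ a t)
    (he : ∀ t, 0 ≤ e t) (hb0 : ∀ t, 0 ≤ b t) (hb : Summable b)
    (h : ∀ t, a (t + 1) ≤ a t - e t + b t) :
    (∃ l, Tendsto a atTop (𝓝 l)) ∧ Summable e := by
  have hbs := hb.hasSum.tendsto_sum_nat
  constructor
  · let c : ℕ → ℝ := fun t => a t - ∑ i ∈ Finset.range t, b i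
    have hanti : Antitone c := antitone_nat_of_succ_le fun t => by
      simp only [c, Finset.sum_range_succ]
      linarith [h t, he t]
    have hbdd : BddBelow (Set.range c) := ⟨-∑' i, b i, by
      rintro _ ⟨t, rfl⟩
      have := hb.sum_le_tsum (Finset.range t) fun i _ => hb0 i
      simp only [c]
      linarith [ha t]⟩
    refine ⟨_, ((tendsto_atTop_ciInf hanti hbdd).add hbs).congr fun t => ?_⟩
    simp [c]
  · refine summable_of_sum_range_le (c := a 0 + ∑' i, b i) he fun n => ?_
    have key : ∑ i ∈ Finset.range n, e i ≤ a 0 - a n + ∑ i ∈ Finset.range n, b i := by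
      induction n with
      | zero => simp
      | succ n ih => rw [Finset.sum_range_succ, Finset.sum_range_succ]; linarith [h n]
    linarith [ha n, hb.sum_le_tsum (Finset.range n) fun i _ => hb0 i]

/-- If the sum of `α` diverges and `α * δ` is summable, then `δ` is frequently small. -/
theorem frequently_lt_of_summable_mul {α δ : ℕ → ℝ} (hα : ∀ t, 0 ≤ α t)
    (hsum : Tendsto (fun T => ∑ t ∈ Finset.range T, α t) atTop atTop)
    (h : Summable fun t => α t * δ t) {ε : ℝ} (hε : 0 < ε) : ∃ᶠ t in atTop, δ t < ε := by
  intro hev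
  have hs : Summable fun t => ε * α t := by
    refine h.of_norm_bounded_eventually_nat ?_
    filter_upwards [hev] with t ht
    rw [Real.norm_of_nonneg (mul_nonneg hε.le (hα t)), mul_comm]
    exact mul_le_mul_of_nonneg_left (not_lt.1 ht) (hα t)
  have hs' : Summable α := (summable_mul_left_iff hε.ne').1 hs
  exact not_tendsto_nhds_of_tendsto_atTop hsum _ hs'.hasSum.tendsto_sum_nat

/-- Convergence of a subgradient-type iteration to a minimizer, from a decrease inequality for a
Lyapunov function with respect to every minimizer. -/
theorem exists_tendsto_minimizer {W : Type*} [NormedAddCommGroup W] [ProperSpace W]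
    {H : Set W} (hH : IsClosed H) {f V : W → ℝ} (hf : Continuous f) (hV : Continuous V)
    (hV0 : V 0 = 0) {C K m : ℝ} (hK : 0 ≤ K) (hC : 0 < C)
    (hVC : ∀ x ∈ H, ∀ w ∈ H, ‖x - w‖ ^ 2 ≤ C * V (x - w))
    (hmin : ∀ x ∈ H, m ≤ f x) (hex : ∃ x ∈ H, f x = m) {α : ℕ → ℝ}
    (hα : IsDiminishingStepSize α) {y : ℕ → W} (hy : ∀ t, y t ∈ H)
    (hstep : ∀ x ∈ H, f x = m → ∀ t,
      V (y (t + 1) - x) ≤ V (y t - x) - 2 * α t * (f (y t) - m) + K * α t ^ 2) :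
    ∃ x ∈ H, f x = m ∧ Tendsto y atTop (𝓝 x) := by
  have hVnn : ∀ x ∈ H, ∀ w ∈ H, 0 ≤ V (x - w) := fun x hx w hw => by
    have := (sq_nonneg _).trans (hVC x hx w hw)
    exact nonneg_of_mul_nonneg_right this hC
  have hconv : ∀ x ∈ H, f x = m → (∃ l, Tendsto (fun t => V (y t - x)) atTop (𝓝 l)) ∧
      Summable fun t => 2 * α t * (f (y t) - m) := fun x hx hfx =>
    tendsto_and_summable_of_le_sub_add (fun t => hVnn _ (hy t) _ hx)
      (fun t => mul_nonneg (mul_nonneg two_pos.le (hα.nonneg t)) (sub_nonneg.2 (hmin _ (hy t))))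
      (fun t => mul_nonneg hK (sq_nonneg _)) (hα.sq_summable.mul_left K) (hstep x hx hfx)
  obtain ⟨x₀, hx₀, hfx₀⟩ := hex
  obtain ⟨⟨l₀, hl₀⟩, hsum⟩ := hconv x₀ hx₀ hfx₀
  obtain ⟨B, hB⟩ := hl₀.bddAbove_range
  have hbdd : ∀ t, y t ∈ Metric.closedBall x₀ (Real.sqrt (C * B)) := fun t => by
    rw [Metric.mem_closedBall, dist_eq_norm]
    refine Real.le_sqrt_of_sq_le ((hVC _ (hy t) _ hx₀).trans ?_)
    exact mul_le_mul_of_nonneg_left (hB ⟨t, rfl⟩) hC.le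
  -- Summability of `α (f y - m)` against divergence of `∑ α` makes `f y` come arbitrarily close to
  -- `m` infinitely often; compactness then gives a cluster point that is a minimizer.
  have hfreq : ∀ n : ℕ, ∃ᶠ t in atTop, f (y t) - m < 1 / ((n : ℝ) + 1) := fun n => by
    refine frequently_lt_of_summable_mul hα.nonneg hα.sum_eq_top ?_ (by positivity)
    have h2 := hsum.mul_left (1 / 2)
    refine h2.congr fun t => ?_
    ring
  obtain ⟨φ, hφ, hφf⟩ := extraction_forall_of_frequently hfreq
  obtain ⟨x, -, ψ, hψ, hlim⟩ := (isCompact_closedBall x₀ (Real.sqrt (C * B))).tendsto_subseq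
    fun n => hbdd (φ n)
  have hxH : x ∈ H := hH.mem_of_tendsto hlim (Eventually.of_forall fun n => hy _)
  have hfx : f x = m := by
    refine le_antisymm ?_ (hmin x hxH)
    have h1 : Tendsto (fun n => f (y (φ (ψ n)))) atTop (𝓝 (f x)) := (hf.tendsto x).comp hlim
    have h2 : Tendsto (fun n => m + 1 / (((ψ n : ℕ) : ℝ) + 1)) atTop (𝓝 (m + 0)) :=
      (tendsto_one_div_add_atTop_nhds_zero_nat.comp hψ.tendsto_atTop).const_add m
    rw [add_zero] at h2
    exact le_of_tendsto_of_tendsto' h1 h2 fun n => by linarith [hφf (ψ n)]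
  -- Recentering at the cluster point: `V (y t - x)` converges, and the subsequence identifies its
  -- limit as `0`.
  obtain ⟨⟨l, hl⟩, -⟩ := hconv x hxH hfx
  have hl0 : l = 0 := by
    have h1 := hl.comp (hφ.comp hψ).tendsto_atTop
    have h2 : Tendsto (fun n => V (y (φ (ψ n)) - x)) atTop (𝓝 (V (x - x))) :=
      (hV.tendsto _).comp (hlim.sub_const x)
    rw [sub_self, hV0] at h2
    exact tendsto_nhds_unique h1 h2
  subst hl0
  refine ⟨x, hxH, hfx, tendsto_iff_norm_sub_tendsto_zero.2 ?_⟩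
  have h3 : Tendsto (fun t => Real.sqrt (C * V (y t - x))) atTop (𝓝 0) := by
    simpa using (hl.const_mul C).sqrt
  exact squeeze_zero (fun _ => norm_nonneg _)
    (fun t => Real.le_sqrt_of_sq_le (hVC _ (hy t) _ hxH)) h3

/-! ### The graph Laplacian and its inverse on zero-sum vectors. -/

namespace SimpleGraph

open Matrix

variable {n : Type*} [Fintype n] [DecidableEq n] (G : SimpleGraph n) [DecidableRel G.Adj]

theorem lapMatrix_mulVec_eq_sum (x : n → ℝ) (i : n) :
    (G.lapMatrix ℝ *ᵥ x) i = ∑ j ∈ G.neighborFinset i, (x i - x j) := by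
  rw [lapMatrix_mulVec_apply, Finset.sum_sub_distrib, Finset.sum_const, card_neighborFinset_eq_degree,
    nsmul_eq_mul]

theorem lapMatrix_dotProduct_comm (x w : n → ℝ) :
    (G.lapMatrix ℝ *ᵥ x) ⬝ᵥ w = x ⬝ᵥ (G.lapMatrix ℝ *ᵥ w) := by
  rw [dotProduct_mulVec, ← mulVec_transpose, (G.isSymm_lapMatrix (R := ℝ)).eq]

theorem sum_lapMatrix_mulVec (x : n → ℝ) : ∑ i, (G.lapMatrix ℝ *ᵥ x) i = 0 := by
  have h := G.lapMatrix_dotProduct_comm x (fun _ => 1)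
  have h1 : G.lapMatrix ℝ *ᵥ (fun _ => 1) = 0 := G.lapMatrix_mulVec_const_eq_zero
  rw [h1, dotProduct_zero] at h
  simpa [dotProduct] using h

variable {G}

/-- The Laplacian of a connected graph has a linear right inverse on zero-sum vectors. -/
theorem Connected.exists_lapMatrix_rightInverse (hG : G.Connected) :
    ∃ R : (n → ℝ) →ₗ[ℝ] (n → ℝ), ∀ w, ∑ i, w i = 0 → G.lapMatrix ℝ *ᵥ R w = w := by
  set L := (G.lapMatrix ℝ).mulVecLin with hL
  obtain ⟨R₀, hR₀⟩ := L.rangeRestrict.exists_rightInverse_of_surjective L.range_rangeRestrict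
  obtain ⟨R, hR⟩ := R₀.exists_extend
  refine ⟨R, fun w hw => ?_⟩
  have hmem : w ∈ LinearMap.range L := by
    -- A functional `u` that kills the range satisfies `⟨u, L u⟩ = 0`, so it is constant by
    -- connectedness and kills `w` too.
    by_contra hn
    obtain ⟨φ, hφ, hle⟩ := Submodule.exists_le_ker_of_notMem hn
    obtain ⟨u, rfl⟩ : ∃ u, dotProductBilin ℝ ℝ u = φ :=
      ⟨fun i => φ (Pi.single i 1), by
        ext i; simp⟩
    have h0 : u ⬝ᵥ G.lapMatrix ℝ *ᵥ u = 0 := by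
      simpa [hL] using hle ⟨u, rfl⟩
    have hconst : ∀ i j, u i = u j := fun i j => by
      have h1 := (G.lapMatrix_toLinearMap₂'_apply'_eq_zero_iff_forall_reachable u).1 (by
        rw [Matrix.toLinearMap₂'_apply']; exact h0)
      exact h1 i j (hG.preconnected i j)
    obtain ⟨i₀⟩ := hG.nonempty
    refine hφ ?_
    simp only [dotProductBilin_apply_apply, dotProduct]
    rw [Finset.sum_congr rfl fun i _ => by rw [hconst i i₀], ← Finset.mul_sum, hw, mul_zero]
  have h1 := LinearMap.congr_fun hR ⟨w, hmem⟩
  have h2 := congrArg Subtype.val (LinearMap.congr_fun hR₀ ⟨w, hmem⟩)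
  simp only [LinearMap.comp_apply, Submodule.subtype_apply] at h1
  rw [h1]
  simpa [hL] using h2

/-- Cauchy–Schwarz over the neighbors; the factor `2` appears because the quadratic form is half the
sum over ordered pairs. Applied to `R w`, it makes the Lyapunov function coercive. -/
theorem lapMatrix_mulVec_sq_le (x : n → ℝ) (i : n) :
    (G.lapMatrix ℝ *ᵥ x) i ^ 2 ≤
      2 * Fintype.card n * (x ⬝ᵥ (G.lapMatrix ℝ *ᵥ x)) := by
  have hQ : x ⬝ᵥ (G.lapMatrix ℝ *ᵥ x) =
      (∑ i, ∑ j, if G.Adj i j then (x i - x j) ^ 2 else 0) / 2 := by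
    rw [← G.lapMatrix_toLinearMap₂' ℝ x, Matrix.toLinearMap₂'_apply']
  have hnn : ∀ i, 0 ≤ ∑ j, if G.Adj i j then (x i - x j) ^ 2 else 0 := fun i =>
    Finset.sum_nonneg fun j _ => by split_ifs <;> positivity
  rw [lapMatrix_mulVec_eq_sum]
  calc (∑ j ∈ G.neighborFinset i, (x i - x j)) ^ 2
      ≤ (G.neighborFinset i).card * ∑ j ∈ G.neighborFinset i, (x i - x j) ^ 2 :=
        sq_sum_le_card_mul_sum_sq
    _ ≤ Fintype.card n * ∑ i, ∑ j, if G.Adj i j then (x i - x j) ^ 2 else 0 := by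
        refine mul_le_mul ?_ ?_ (Finset.sum_nonneg fun _ _ => sq_nonneg _) (by positivity)
        · exact_mod_cast Finset.card_le_univ _
        · rw [neighborFinset_eq_filter, Finset.sum_filter]
          exact Finset.single_le_sum (f := fun i => ∑ j, if G.Adj i j then (x i - x j) ^ 2 else 0)
            (fun i _ => hnn i) (Finset.mem_univ i)
    _ = _ := by rw [hQ]; ring

end SimpleGraph

/-! ### The relaxed local LP: attainment, duality, exact penalty. -/

namespace CoupledMILP

variable {N S : ℕ} (P : CoupledMILP N S)

/-- The optimal cost of the relaxed local LP. -/
noncomputable def relaxedValue (M : ℝ) (i : Fin N) (y : Fin S → ℝ) : ℝ :=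
  sInf ((fun w : P.Var i × ℝ => P.c i ⬝ᵥ w.1 + M * w.2) '' P.relaxedFeasible i y)

variable {P}

theorem isCompact_convX {i : Fin N} (hX : IsCompact (P.X i)) : IsCompact (P.convX i) := by
  obtain ⟨F, hF, h⟩ := P.exists_finite_convexHull_eq hX
  exact h ▸ hF.isCompact_convexHull ℝ

theorem convX_nonempty {i : Fin N} (h : (P.X i).Nonempty) : (P.convX i).Nonempty :=
  h.convexHull

/-- For fixed `z` the cheapest `v` is the sup norm of the positive part of `A z - y`, which leaves a
continuous function on a compact set. -/
theorem exists_isRelaxedOptimal {i : Fin N} (hX : IsCompact (P.X i)) (hne : (P.X i).Nonempty)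
    {M : ℝ} (hM : 0 ≤ M) (y : Fin S → ℝ) :
    ∃ z v, P.IsRelaxedOptimal M i y z v := by
  have hcont : Continuous fun z : P.Var i =>
      P.c i ⬝ᵥ z + M * ‖((P.A i).mulVec z - y) ⊔ 0‖ := by
    have : Continuous fun z : P.Var i => (P.A i).mulVec z :=
      Continuous.matrix_mulVec continuous_const continuous_id
    have h2 : Continuous fun z : P.Var i => P.c i ⬝ᵥ z :=
      Continuous.dotProduct continuous_const continuous_id
    exact h2.add (continuous_const.mul (continuous_pi fun s =>
      ((continuous_pi_iff.1 this s).sub continuous_const).sup continuous_const).norm)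
  obtain ⟨z, hz, hmin⟩ := (isCompact_convX hX).exists_isMinOn (convX_nonempty hne)
    hcont.continuousOn
  refine ⟨z, ‖((P.A i).mulVec z - y) ⊔ 0‖, ⟨fun s => ?_, hz, norm_nonneg _⟩, ?_⟩
  · have h1 := norm_le_pi_norm (((P.A i).mulVec z - y) ⊔ 0) s
    have h2 : (P.A i).mulVec z s - y s ≤ (((P.A i).mulVec z - y) ⊔ 0) s := le_sup_left
    have h3 := (le_abs_self _).trans h1
    dsimp only
    linarith
  · rintro ⟨z', v'⟩ ⟨h1, h2, h3⟩
    dsimp only at h1 h2 h3 ⊢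
    have h4 : ‖((P.A i).mulVec z' - y) ⊔ 0‖ ≤ v' := by
      rw [pi_norm_le_iff_of_nonneg h3]
      intro s
      have h5 : 0 ≤ (((P.A i).mulVec z' - y) ⊔ 0) s := le_sup_right
      rw [Real.norm_of_nonneg h5]
      exact sup_le (sub_le_iff_le_add'.2 (h1 s)) h3
    have h6 := isMinOn_iff.1 hmin z' h2
    have h7 := mul_le_mul_of_nonneg_left h4 hM
    linarith

theorem IsRelaxedOptimal.relaxedValue_eq {M : ℝ} {i : Fin N} {y : Fin S → ℝ} {z : P.Var i} {v : ℝ}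
    (h : P.IsRelaxedOptimal M i y z v) : P.relaxedValue M i y = P.c i ⬝ᵥ z + M * v :=
  IsLeast.csInf_eq (a := P.c i ⬝ᵥ z + M * v)
    ⟨⟨(z, v), h.1, rfl⟩, by rintro _ ⟨w, hw, rfl⟩; exact h.2 w hw⟩

section

variable {i : Fin N} (hX : IsCompact (P.X i)) (hne : (P.X i).Nonempty) {M : ℝ} (hM : 0 ≤ M)

include hX hne hM

theorem relaxedValue_le {y : Fin S → ℝ} {w : P.Var i × ℝ} (hw : w ∈ P.relaxedFeasible i y) :
    P.relaxedValue M i y ≤ P.c i ⬝ᵥ w.1 + M * w.2 := by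
  obtain ⟨z, v, h⟩ := exists_isRelaxedOptimal hX hne hM y
  exact h.relaxedValue_eq.trans_le (h.2 w hw)

/-- Raising `v` by the sup-norm distance keeps an optimal pair for `y'` feasible for `y`. -/
theorem relaxedValue_le_add (y y' : Fin S → ℝ) :
    P.relaxedValue M i y ≤ P.relaxedValue M i y' + M * ‖y - y'‖ := by
  obtain ⟨z, v, h⟩ := exists_isRelaxedOptimal hX hne hM y'
  have h1 : (z, v + ‖y - y'‖) ∈ P.relaxedFeasible i y := by
    refine ⟨fun s => ?_, h.1.2.1, add_nonneg h.1.2.2 (norm_nonneg _)⟩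
    have h2 := h.1.1 s
    have h3 := (neg_abs_le _).trans' (neg_le_neg (norm_le_pi_norm (y - y') s))
    simp only [Pi.sub_apply] at h3
    dsimp only at h2 ⊢
    linarith
  have := relaxedValue_le hX hne hM h1
  rw [h.relaxedValue_eq]
  dsimp only at this
  linarith

theorem continuous_relaxedValue : Continuous (P.relaxedValue M i) := by
  refine (LipschitzWith.of_le_add_mul ⟨M, hM⟩ fun y y' => ?_).continuous
  rw [dist_eq_norm]
  exact relaxedValue_le_add hX hne hM y y'

/-- Strong duality for the relaxed local LP. -/
theorem relaxedValue_le_lagrangian {y μ : Fin S → ℝ} (hμ : P.IsDualOptimal M i y μ)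
    {z : P.Var i} (hz : z ∈ P.convX i) {v : ℝ} (hv : 0 ≤ v) :
    P.relaxedValue M i y ≤ P.lagrangian M i y z v μ := by
  obtain ⟨F, hF, hFX⟩ := P.exists_finite_convexHull_eq hX
  -- With `r = -1` the last conclusion reads `∑ ν ≤ M`, so the Lagrangian at `ν` is nondecreasing in
  -- `v`. Dual optimality transfers the resulting bound from `ν` to `μ`.
  obtain ⟨ν, hν, h1, h2⟩ := exists_multiplier hF (dotProductBilin ℝ ℝ (P.c i))
    (P.A i).mulVecLin y (fun _ => -1) hM (P.relaxedValue M i y) (by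
      intro z hz v hv h
      refine relaxedValue_le hX hne hM (w := (z, v)) ⟨fun s => ?_, hFX ▸ hz, hv⟩
      have := h s
      simp at this
      dsimp only
      linarith)
  have h3 : (P.relaxedValue M i y : EReal) ≤ P.dualFunction M i y ν := by
    refine le_iInf fun z => le_iInf fun hz => le_iInf fun v => le_iInf fun hv => ?_
    rw [EReal.coe_le_coe_iff]
    have h4 := h1 z (hFX ▸ hz)
    have h5 := mul_nonneg h2 hv
    simp only [lagrangian, dotProduct, dotProductBilin_apply_apply, Matrix.mulVecLin_apply,
      Pi.sub_apply, mul_sub, mul_add, Finset.sum_sub_distrib, Finset.sum_add_distrib,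
      ← Finset.sum_mul, mul_neg, mul_one, Finset.sum_neg_distrib] at h4 h5 ⊢
    linarith
  have h6 := h3.trans (hμ.2 ν hν)
  have h7 : P.dualFunction M i y μ ≤ (P.lagrangian M i y z v μ : EReal) :=
    iInf₂_le_of_le z hz (iInf₂_le v hv)
  exact EReal.coe_le_coe_iff.1 (h6.trans h7)

/-- Otherwise the coefficient `M - ∑ μ` of `v` is negative and the Lagrangian is unbounded below,
against strong duality. -/
theorem IsDualOptimal.sum_le {y μ : Fin S → ℝ} (hμ : P.IsDualOptimal M i y μ) :
    ∑ s, μ s ≤ M := by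
  obtain ⟨z, hz⟩ := convX_nonempty hne
  by_contra! hlt
  set B := P.lagrangian M i y z 0 μ - P.relaxedValue M i y with hB
  have hpos : 0 < ∑ s, μ s - M := sub_pos.2 hlt
  have hB0 : 0 ≤ B := sub_nonneg.2 (relaxedValue_le_lagrangian hX hne hM hμ hz le_rfl)
  -- This `v` puts the Lagrangian exactly one below the relaxed value.
  have hv : 0 ≤ (B + 1) / (∑ s, μ s - M) := by positivity
  have h1 := relaxedValue_le_lagrangian hX hne hM hμ hz hv
  have h2 : P.lagrangian M i y z ((B + 1) / (∑ s, μ s - M)) μ =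
      P.lagrangian M i y z 0 μ - (∑ s, μ s - M) * ((B + 1) / (∑ s, μ s - M)) := by
    simp only [lagrangian, mul_sub, mul_add, Finset.sum_sub_distrib, Finset.sum_add_distrib,
      ← Finset.sum_mul]
    ring
  rw [h2, mul_div_cancel₀ _ hpos.ne'] at h1
  linarith

/-- Minus a dual optimal solution is a subgradient of the relaxed value. -/
theorem IsDualOptimal.dotProduct_sub_le {y μ : Fin S → ℝ} (hμ : P.IsDualOptimal M i y μ)
    (x : Fin S → ℝ) :
    μ ⬝ᵥ (y - x) ≤ P.relaxedValue M i x - P.relaxedValue M i y := by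
  -- An optimal pair for `x` is tested in the Lagrangian at `y`.
  obtain ⟨z, v, h⟩ := exists_isRelaxedOptimal hX hne hM x
  have h1 := relaxedValue_le_lagrangian hX hne hM hμ h.1.2.1 h.1.2.2
  have h2 : ∑ s, μ s * ((P.A i).mulVec z s - (y s + v)) ≤ ∑ s, μ s * (x s - y s) :=
    Finset.sum_le_sum fun s _ => mul_le_mul_of_nonneg_left (by
      have := h.1.1 s
      dsimp only at this
      linarith) (hμ.1 s)
  rw [h.relaxedValue_eq]
  simp only [lagrangian] at h1
  simp only [dotProduct, Pi.sub_apply, mul_sub, Finset.sum_sub_distrib] at h1 h2 ⊢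
  linarith

theorem relaxedValue_le_p {y : Fin S → ℝ} (hy : y ∈ P.Y i) : P.relaxedValue M i y ≤ P.p i y := by
  refine le_csInf (hy.image _) ?_
  rintro _ ⟨z, hz, rfl⟩
  have := relaxedValue_le hX hne hM (y := y) (w := (z, 0)) ⟨fun s => by simpa using hz.1 s,
    hz.2, le_rfl⟩
  simpa using this

end

theorem p_le {i : Fin N} (hX : IsCompact (P.X i)) {y : Fin S → ℝ} {z : P.Var i}
    (hz : z ∈ P.subFeasible i y) : P.p i y ≤ P.c i ⬝ᵥ z := by
  refine csInf_le ?_ ⟨z, hz, rfl⟩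
  have hc : Continuous fun z : P.Var i => P.c i ⬝ᵥ z :=
    Continuous.dotProduct continuous_const continuous_id
  exact ((isCompact_convX hX).bddBelow_image hc.continuousOn).mono
    (Set.image_mono fun w hw => hw.2)

/-- Lagrange multipliers for the restricted LP. -/
theorem IsLPOptimal.exists_multiplier (hX : ∀ i, IsCompact (P.X i)) {σ : Fin S → ℝ}
    {z : ∀ i, P.Var i} (hz : P.IsLPOptimal σ z) :
    ∃ μ : Fin S → ℝ, 0 ≤ μ ∧ ∀ w : ∀ i, P.Var i, (∀ i, w i ∈ P.convX i) →
      P.cost z ≤ P.cost w + μ ⬝ᵥ (∑ i, (P.A i).mulVec (w i) - (P.b - σ)) := by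
  choose F hF hFX using fun i => P.exists_finite_convexHull_eq (hX i)
  have hmem : ∀ w : ∀ i, P.Var i,
      w ∈ convexHull ℝ (Set.univ.pi F) ↔ ∀ i, w i ∈ P.convX i := fun w => by
    simp [hFX]
  let k : (∀ i, P.Var i) →ₗ[ℝ] ℝ :=
    ∑ i, (dotProductBilin ℝ ℝ (P.c i)).comp (LinearMap.proj i)
  let a : (∀ i, P.Var i) →ₗ[ℝ] (Fin S → ℝ) := ∑ i, (P.A i).mulVecLin.comp (LinearMap.proj i)
  have hk : ∀ w, k w = P.cost w := fun w => by simp [k, cost]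
  have ha : ∀ w, a w = ∑ i, (P.A i).mulVec (w i) := fun w => by simp [a]
  -- The product of the polytopes is again a polytope; `r = 0` and `m = 0` neutralize the scalar
  -- variable.
  obtain ⟨μ, hμ, h, -⟩ := _root_.exists_multiplier (Set.Finite.pi hF) k a (P.b - σ) 0 le_rfl
    (P.cost z) (by
      intro w hw v _ hle
      rw [hk, zero_mul, add_zero]
      rw [ha, smul_zero, add_zero] at hle
      exact hz.2 w ⟨hle, (hmem w).1 hw⟩)
  exact ⟨μ, hμ, fun w hw => by simpa only [hk, ha] using h w ((hmem w).2 hw)⟩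

/-- Exact penalty: for large penalties, the violations are controlled by the excess cost. -/
theorem IsLPOptimal.exists_exact_penalty (hX : ∀ i, IsCompact (P.X i)) {σ : Fin S → ℝ}
    {z : ∀ i, P.Var i} (hz : P.IsLPOptimal σ z) :
    ∃ M₀ : ℝ, 0 < M₀ ∧ ∀ M, M₀ ≤ M → ∀ y : Fin N → Fin S → ℝ, ∑ i, y i = P.b - σ →
      ∀ w : ∀ i, P.Var i, ∀ v : Fin N → ℝ, (∀ i, (w i, v i) ∈ P.relaxedFeasible i (y i)) →
        P.cost z + ∑ i, v i ≤ ∑ i, (P.c i ⬝ᵥ w i + M * v i) := by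
  obtain ⟨μ, hμ, h⟩ := hz.exists_multiplier hX
  have hsum : 0 ≤ ∑ s, μ s := Finset.sum_nonneg fun s _ => hμ s
  -- `∑ μ` pays for the violations in the LP bound; the extra `1` leaves `∑ v` as surplus.
  refine ⟨∑ s, μ s + 1, by linarith, fun M hM y hy w v hw => ?_⟩
  have h1 := h w fun i => (hw i).2.1
  have hv : 0 ≤ ∑ i, v i := Finset.sum_nonneg fun i _ => (hw i).2.2
  have h2 : μ ⬝ᵥ (∑ i, (P.A i).mulVec (w i) - (P.b - σ)) ≤ ∑ s, μ s * ∑ i, v i := by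
    refine Finset.sum_le_sum fun s _ => mul_le_mul_of_nonneg_left ?_ (hμ s)
    rw [← hy, Pi.sub_apply, Finset.sum_apply, Finset.sum_apply, sub_le_iff_le_add',
      ← Finset.sum_add_distrib]
    exact Finset.sum_le_sum fun i _ => (hw i).1 s
  rw [← Finset.sum_mul] at h2
  rw [Finset.sum_add_distrib, ← Finset.mul_sum]
  have h3 := mul_le_mul_of_nonneg_right hM hv
  simp only [cost] at h1 ⊢
  linarith

end CoupledMILP

/-! ### The Lyapunov function. -/

namespace SimpleGraph

open Matrix

/-- Writing `w = L (R w)` and using the symmetry of `L` turns both cross terms into `⟨m, w⟩`, with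
no trace of the graph; `R` itself need not be symmetric. -/
theorem lapMatrix_lyapunov_step {n : Type*} [Fintype n] [DecidableEq n] {G : SimpleGraph n}
    [DecidableRel G.Adj] {R : (n → ℝ) →ₗ[ℝ] (n → ℝ)}
    (hR : ∀ w, ∑ i, w i = 0 → G.lapMatrix ℝ *ᵥ R w = w) {w : n → ℝ} (hw : ∑ i, w i = 0)
    (m : n → ℝ) (a : ℝ) :
    (w + a • (G.lapMatrix ℝ *ᵥ m)) ⬝ᵥ R (w + a • (G.lapMatrix ℝ *ᵥ m)) =
      w ⬝ᵥ R w + 2 * a * (m ⬝ᵥ w) + a ^ 2 * (m ⬝ᵥ (G.lapMatrix ℝ *ᵥ m)) := by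
  have hL := hR _ (G.sum_lapMatrix_mulVec m)
  have h1 : (G.lapMatrix ℝ *ᵥ m) ⬝ᵥ R w = m ⬝ᵥ w := by
    rw [lapMatrix_dotProduct_comm, hR w hw]
  have h2 : w ⬝ᵥ R (G.lapMatrix ℝ *ᵥ m) = m ⬝ᵥ w := by
    conv_lhs => rw [← hR w hw]
    rw [lapMatrix_dotProduct_comm, hL, dotProduct_comm, h1]
  have h3 : (G.lapMatrix ℝ *ᵥ m) ⬝ᵥ R (G.lapMatrix ℝ *ᵥ m) = m ⬝ᵥ (G.lapMatrix ℝ *ᵥ m) := by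
    rw [lapMatrix_dotProduct_comm, hL]
  simp only [map_add, map_smul, add_dotProduct, dotProduct_add, smul_dotProduct, dotProduct_smul,
    h1, h2, h3, smul_eq_mul]
  ring

/-- A quadratic Lyapunov function for Laplacian updates of zero-sum families of vectors. -/
theorem Connected.exists_lyapunov {N S : ℕ} {G : SimpleGraph (Fin N)} [DecidableRel G.Adj]
    (hG : G.Connected) (M : ℝ) :
    ∃ (V : (Fin N → Fin S → ℝ) → ℝ) (C K : ℝ), Continuous V ∧ V 0 = 0 ∧ 0 < C ∧ 0 ≤ K ∧
      (∀ w, ∑ i, w i = 0 → ‖w‖ ^ 2 ≤ C * V w) ∧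
      ∀ w m : Fin N → Fin S → ℝ, ∑ i, w i = 0 → 0 ≤ m → (∀ i s, m i s ≤ M) → ∀ a : ℝ,
        V (fun i => w i + a • ∑ j ∈ G.neighborFinset i, (m i - m j)) ≤
          V w + 2 * a * ∑ i, m i ⬝ᵥ w i + K * a ^ 2 := by
  obtain ⟨R, hR⟩ := hG.exists_lapMatrix_rightInverse
  let V : (Fin N → Fin S → ℝ) → ℝ := fun w => ∑ s, (fun i => w i s) ⬝ᵥ R fun i => w i s
  let Q : (Fin N → Fin S → ℝ) → ℝ := fun m =>
    ∑ s, (fun i => m i s) ⬝ᵥ (G.lapMatrix ℝ *ᵥ fun i => m i s)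
  have hRc : Continuous R := R.continuous_of_finiteDimensional
  have hVc : Continuous V := by
    refine continuous_finsetSum _ fun s _ => ?_
    have : Continuous fun w : Fin N → Fin S → ℝ => fun i => w i s := by fun_prop
    exact this.dotProduct (hRc.comp this)
  have hQc : Continuous Q := by
    refine continuous_finsetSum _ fun s _ => ?_
    have : Continuous fun w : Fin N → Fin S → ℝ => fun i => w i s := by fun_prop
    exact this.dotProduct (continuous_const.matrix_mulVec this)
  -- The second-order term is bounded over the box of admissible multipliers. The box is empty for
  -- negative `M`, hence `max K 0` below.
  obtain ⟨K, hK⟩ := (isCompact_Icc (a := (0 : Fin N → Fin S → ℝ))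
    (b := fun _ _ => M)).bddAbove_image hQc.continuousOn
  have hN : 0 < N := Fin.pos_iff_nonempty.2 hG.nonempty
  have hsum : ∀ {w : Fin N → Fin S → ℝ}, ∑ i, w i = 0 → ∀ s, ∑ i, w i s = 0 := fun hw s => by
    simpa using congrFun hw s
  have hC : (0 : ℝ) < 2 * N := by positivity
  refine ⟨V, 2 * N, max K 0, hVc, ?_, hC, le_max_right _ _, fun w hw => ?_, ?_⟩
  · simp [V, dotProduct]
  · have hterm : ∀ i s, w i s ^ 2 ≤ 2 * N * ((fun i => w i s) ⬝ᵥ R fun i => w i s) := by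
      intro i s
      have h1 := lapMatrix_mulVec_sq_le (G := G) (R fun i => w i s) i
      rw [hR _ (hsum hw s), Fintype.card_fin, dotProduct_comm] at h1
      exact h1
    have hnn : ∀ s, 0 ≤ (fun i => w i s) ⬝ᵥ R fun i => w i s := fun s =>
      nonneg_of_mul_nonneg_right ((sq_nonneg _).trans (hterm ⟨0, hN⟩ s)) hC
    have hle : ∀ i s, w i s ^ 2 ≤ 2 * N * V w := fun i s =>
      (hterm i s).trans (mul_le_mul_of_nonneg_left
        (Finset.single_le_sum (f := fun s => (fun i => w i s) ⬝ᵥ R fun i => w i s)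
          (fun s _ => hnn s) (Finset.mem_univ s)) hC.le)
    have hV0 : 0 ≤ 2 * N * V w := mul_nonneg hC.le (Finset.sum_nonneg fun s _ => hnn s)
    have hnorm : ‖w‖ ≤ Real.sqrt (2 * N * V w) := by
      refine (pi_norm_le_iff_of_nonneg (Real.sqrt_nonneg _)).2 fun i =>
        (pi_norm_le_iff_of_nonneg (Real.sqrt_nonneg _)).2 fun s => ?_
      exact Real.abs_le_sqrt (hle i s)
    calc ‖w‖ ^ 2 ≤ Real.sqrt (2 * N * V w) ^ 2 := pow_le_pow_left₀ (norm_nonneg _) hnorm 2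
      _ = _ := Real.sq_sqrt hV0
  · intro w m hw hm hmM a
    have h1 : V (fun i => w i + a • ∑ j ∈ G.neighborFinset i, (m i - m j)) =
        V w + 2 * a * ∑ i, m i ⬝ᵥ w i + a ^ 2 * Q m := by
      have h2 : ∀ s, (fun i => (w i + a • ∑ j ∈ G.neighborFinset i, (m i - m j)) s) =
          (fun i => w i s) + a • (G.lapMatrix ℝ *ᵥ fun i => m i s) := fun s => by
        ext i
        simp [lapMatrix_mulVec_eq_sum]
      have h3 : ∑ i, m i ⬝ᵥ w i = ∑ s, (fun i => m i s) ⬝ᵥ fun i => w i s := Finset.sum_comm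
      have h4 := fun s => lapMatrix_lyapunov_step hR (hsum hw s) (fun i => m i s) a
      simp only [V, Q, h2, h3, h4, Finset.sum_add_distrib, Finset.mul_sum]
    have h2 : Q m ≤ max K 0 := (hK ⟨m, ⟨hm, fun i s => hmM i s⟩, rfl⟩).trans (le_max_left _ _)
    have h3 := mul_le_mul_of_nonneg_left h2 (sq_nonneg a)
    linarith

end SimpleGraph

/-! ### Runs of the algorithm and the main theorem. -/

namespace CoupledMILP

variable {N S : ℕ} {P : CoupledMILP N S} {G : SimpleGraph (Fin N)} [DecidableRel G.Adj]
  {M : ℝ} {α : ℕ → ℝ} {y : ℕ → Fin N → Fin S → ℝ} {z : ℕ → ∀ i, P.Var i} {v : ℕ → Fin N → ℝ}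
  {μ : ℕ → Fin N → Fin S → ℝ}

theorem IsAlgorithmRun.sum_eq (h : P.IsAlgorithmRun G M α y z v μ) (t : ℕ) :
    ∑ i, y t i = ∑ i, y 0 i := by
  induction t with
  | zero => rfl
  | succ t ih =>
    rw [← ih]
    ext s
    have h1 := G.sum_lapMatrix_mulVec fun i => μ t i s
    simp only [G.lapMatrix_mulVec_eq_sum] at h1
    simp only [h.update t, Finset.sum_add_distrib, Finset.sum_apply, Pi.add_apply, Pi.smul_apply,
      smul_eq_mul, Pi.sub_apply, ← Finset.mul_sum, h1, mul_zero, add_zero]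

/-- Splitting the resource along an optimal solution of the restricted LP. -/
theorem exists_allocation (hN : 0 < N) {β : Fin S → ℝ} {w : ∀ i, P.Var i}
    (hw : ∑ i, (P.A i).mulVec (w i) ≤ β) :
    ∃ x : Fin N → Fin S → ℝ, ∑ i, x i = β ∧ ∀ i, (P.A i).mulVec (w i) ≤ x i := by
  -- Agent `0` receives all the slack.
  refine ⟨fun i => (P.A i).mulVec (w i) +
    Pi.single (M := fun _ : Fin N => Fin S → ℝ) ⟨0, hN⟩ (β - ∑ i, (P.A i).mulVec (w i)) i, ?_,
    fun i => le_add_of_nonneg_right ?_⟩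
  · rw [Finset.sum_add_distrib, Finset.sum_pi_single']
    simp
  · refine (Pi.single_nonneg (α := fun _ : Fin N => Fin S → ℝ) (i := ⟨0, hN⟩)).2 ?_ i
    exact sub_nonneg.2 hw

end CoupledMILP

theorem proposition1 {N S : ℕ} (P : CoupledMILP N S)
    (hXcompact : ∀ i, IsCompact (P.X i)) (hXnonempty : ∀ i, (P.X i).Nonempty)
    (σ : Fin S → ℝ) (hσ : 0 ≤ σ)
    (hfeasible : (P.lpFeasible σ).Nonempty) (hunique : ∃! z, P.IsLPOptimal σ z)
    (G : SimpleGraph (Fin N)) [DecidableRel G.Adj] (hG : G.Connected) :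
    ∃ M₀ : ℝ, 0 < M₀ ∧ ∀ M : ℝ, M₀ ≤ M →
      ∀ α : ℕ → ℝ, IsDiminishingStepSize α →
      ∀ (y : ℕ → Fin N → Fin S → ℝ) (z : ℕ → ∀ i, P.Var i) (v : ℕ → Fin N → ℝ)
        (μ : ℕ → Fin N → Fin S → ℝ),
      ∑ i, y 0 i = P.b - σ →
      P.IsAlgorithmRun G M α y z v μ →
        (∀ t, ∑ i, y t i = P.b - σ) ∧
        (∃ yStar : Fin N → Fin S → ℝ, P.IsMasterOptimal σ yStar ∧
          ∀ i, Tendsto (fun t => ‖y t i - yStar i‖) atTop (𝓝 0)) ∧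
        (∀ zInf : ∀ i, P.Var i, MapClusterPt zInf atTop z →
          P.IsLPOptimal σ zInf ∧ P.cost zInf = P.lpValue σ) := by
  obtain ⟨w, hw, -⟩ := hunique
  obtain ⟨M₀, hM₀, hpen⟩ := hw.exists_exact_penalty hXcompact
  refine ⟨M₀, hM₀, fun M hM α hα y z v μ hy0 hrun => ?_⟩
  have hM' : 0 ≤ M := hM₀.le.trans hM
  have hN : 0 < N := Fin.pos_iff_nonempty.2 hG.nonempty
  have hsum : ∀ t, ∑ i, y t i = P.b - σ := fun t => (hrun.sum_eq t).trans hy0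
  set f : (Fin N → Fin S → ℝ) → ℝ := fun x => ∑ i, P.relaxedValue M i (x i) with hf
  have hfc : Continuous f := continuous_finsetSum _ fun i _ =>
    (CoupledMILP.continuous_relaxedValue (hXcompact i) (hXnonempty i) hM').comp
      (continuous_apply i)
  have hH : IsClosed {x : Fin N → Fin S → ℝ | ∑ i, x i = P.b - σ} :=
    isClosed_eq (continuous_finsetSum _ fun i _ => continuous_apply i) continuous_const
  -- Key estimate: the total violation is at most the excess of `f` over the LP optimum.
  have hopt : ∀ x : Fin N → Fin S → ℝ, ∑ i, x i = P.b - σ → ∀ (u : ∀ i, P.Var i) (r : Fin N → ℝ),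
      (∀ i, P.IsRelaxedOptimal M i (x i) (u i) (r i)) → P.cost w + ∑ i, r i ≤ f x := by
    intro x hx u r hr
    refine (hpen M hM x hx u r fun i => (hr i).1).trans_eq ?_
    exact Finset.sum_congr rfl fun i _ => (hr i).relaxedValue_eq.symm
  have hmin : ∀ x ∈ {x : Fin N → Fin S → ℝ | ∑ i, x i = P.b - σ}, P.cost w ≤ f x := by
    intro x hx
    choose u r hr using fun i =>
      CoupledMILP.exists_isRelaxedOptimal (hXcompact i) (hXnonempty i) hM' (x i)
    have := hopt x hx u r hr
    have h2 : 0 ≤ ∑ i, r i := Finset.sum_nonneg fun i _ => (hr i).1.2.2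
    linarith
  have hex : ∃ x ∈ {x : Fin N → Fin S → ℝ | ∑ i, x i = P.b - σ}, f x = P.cost w := by
    obtain ⟨x, hx, hwx⟩ := CoupledMILP.exists_allocation hN hw.1.1
    refine ⟨x, hx, le_antisymm (Finset.sum_le_sum fun i _ => ?_) (hmin x hx)⟩
    have := CoupledMILP.relaxedValue_le (hXcompact i) (hXnonempty i) hM' (y := x i) (w := (w i, 0))
      ⟨fun s => by simpa using hwx i s, hw.1.2 i, le_rfl⟩
    simpa using this
  obtain ⟨V, C, K, hVc, hV0, hC, hK, hVC, hstep⟩ := hG.exists_lyapunov (S := S) M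
  obtain ⟨x, hx, hfx, hlim⟩ := exists_tendsto_minimizer hH hfc hVc hV0 hK hC
    (fun a ha b hb => hVC _ (by
      rw [Set.mem_ofPred_eq] at ha hb
      simp [Finset.sum_sub_distrib, ha, hb])) hmin hex hα hsum (by
    intro x hx hfx t
    have hzero : ∑ i, (y t - x) i = 0 := by
      rw [Set.mem_ofPred_eq] at hx
      simp [Finset.sum_sub_distrib, hx, hsum t]
    have h1 := hstep (y t - x) (μ t) hzero (fun i => (hrun.dual t i).1) (fun i s =>
      (Finset.single_le_sum (fun s _ => (hrun.dual t i).1 s) (Finset.mem_univ s)).trans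
        ((hrun.dual t i).sum_le (hXcompact i) (hXnonempty i) hM')) (α t)
    have h2 : (fun i => (y t - x) i + α t • ∑ j ∈ G.neighborFinset i, (μ t i - μ t j)) =
        y (t + 1) - x := by
      ext1 i
      rw [Pi.sub_apply, Pi.sub_apply, hrun.update t i]
      abel
    rw [h2] at h1
    have h3 : ∑ i, μ t i ⬝ᵥ (y t - x) i ≤ f x - f (y t) := by
      rw [hf, ← Finset.sum_sub_distrib]
      exact Finset.sum_le_sum fun i _ =>
        (hrun.dual t i).dotProduct_sub_le (hXcompact i) (hXnonempty i) hM' (x i)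
    have h4 := mul_le_mul_of_nonneg_left h3 (mul_nonneg two_pos.le (hα.nonneg t))
    rw [hfx] at h4
    linarith)
  have hvnn : ∀ (t : ℕ) i, 0 ≤ v t i := fun t i => (hrun.primal t i).1.2.2
  choose u r hr using fun i =>
    CoupledMILP.exists_isRelaxedOptimal (hXcompact i) (hXnonempty i) hM' (x i)
  -- At a minimizer the excess is zero, so the relaxed solutions have no violation and are feasible
  -- for the original subproblems.
  have hr0 : ∀ i, r i = 0 := by
    have h1 := hopt x hx u r hr
    have h2 : ∀ i ∈ Finset.univ, 0 ≤ r i := fun i _ => (hr i).1.2.2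
    have h3 : ∑ i, r i = 0 := le_antisymm (by linarith) (Finset.sum_nonneg h2)
    exact fun i => (Finset.sum_eq_zero_iff_of_nonneg h2).1 h3 i (Finset.mem_univ i)
  have hu : ∀ i, u i ∈ P.subFeasible i (x i) := fun i =>
    ⟨fun s => by simpa [hr0 i] using (hr i).1.1 s, (hr i).1.2.1⟩
  refine ⟨hsum, ⟨x, ⟨⟨hx, fun i => ⟨u i, hu i⟩⟩, fun x' hx' => ?_⟩, fun i => ?_⟩,
    fun zInf hz => ?_⟩
  -- `f` bounds the master cost from below on its feasible set, and the two agree at `x`.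
  · calc ∑ i, P.p i (x i) ≤ ∑ i, P.c i ⬝ᵥ u i :=
          Finset.sum_le_sum fun i _ => CoupledMILP.p_le (hXcompact i) (hu i)
      _ = f x := Finset.sum_congr rfl fun i _ => by
          rw [(hr i).relaxedValue_eq, hr0 i, mul_zero, add_zero]
      _ ≤ f x' := hfx.trans_le (hmin x' hx'.1)
      _ ≤ _ := Finset.sum_le_sum fun i _ =>
          CoupledMILP.relaxedValue_le_p (hXcompact i) (hXnonempty i) hM' (hx'.2 i)
  · exact tendsto_iff_norm_sub_tendsto_zero.1 (tendsto_pi_nhds.1 hlim i)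
  · have hflim : Tendsto (fun t => f (y t)) atTop (𝓝 (P.cost w)) :=
      hfx ▸ (hfc.tendsto x).comp hlim
    have hvlim : Tendsto (fun t => ∑ i, v t i) atTop (𝓝 0) := by
      refine squeeze_zero (fun t => Finset.sum_nonneg fun i _ => hvnn t i)
        (fun t => ?_) (by simpa using hflim.sub_const (P.cost w))
      linarith [hopt _ (hsum t) _ _ (hrun.primal t)]
    have hcostlim : Tendsto (fun t => P.cost (z t)) atTop (𝓝 (P.cost w)) := by
      have h1 : ∀ t, P.cost (z t) = f (y t) - M * ∑ i, v t i := fun t => by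
        simp only [hf, (hrun.primal t _).relaxedValue_eq, Finset.sum_add_distrib,
          ← Finset.mul_sum, CoupledMILP.cost, add_sub_cancel_right]
      simp only [h1]
      simpa using hflim.sub (hvlim.const_mul M)
    obtain ⟨ψ, hψ, hzlim⟩ := hz.tendsto_subseq
    have hzi := fun i => tendsto_pi_nhds.1 hzlim i
    have hcost : P.cost zInf = P.cost w := by
      have hc : Continuous P.cost := continuous_finsetSum _ fun i _ =>
        Continuous.dotProduct continuous_const (continuous_apply i)
      exact tendsto_nhds_unique ((hc.tendsto zInf).comp hzlim) (hcostlim.comp hψ.tendsto_atTop)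
    have hfeas : zInf ∈ P.lpFeasible σ := by
      refine ⟨fun s => ?_, fun i => (CoupledMILP.isCompact_convX (hXcompact i)).isClosed.mem_of_tendsto
        (hzi i) (Eventually.of_forall fun n => (hrun.primal _ i).1.2.1)⟩
      have hc : Continuous fun q : ∀ i, P.Var i => (∑ i, (P.A i).mulVec (q i)) s :=
        (continuous_apply s).comp (continuous_finsetSum _ fun i _ =>
          continuous_const.matrix_mulVec (continuous_apply i))
      refine le_of_tendsto_of_tendsto' ((hc.tendsto zInf).comp hzlim)
        (by simpa using (hvlim.comp hψ.tendsto_atTop).const_add ((P.b - σ) s)) fun n => ?_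
      simp only [Function.comp_apply]
      -- Summing the local constraints bounds the resource usage by `b - σ` plus the vanishing total
      -- violation.
      rw [← Pi.sub_apply, ← hsum (ψ n), Finset.sum_apply, Finset.sum_apply, ← Finset.sum_add_distrib]
      exact Finset.sum_le_sum fun i _ => (hrun.primal (ψ n) i).1.1 s
    have hLP : P.IsLPOptimal σ zInf := ⟨hfeas, fun q hq => hcost.trans_le (hw.2 q hq)⟩
    have hleast : IsLeast (P.cost '' P.lpFeasible σ) (P.cost zInf) := by
      refine ⟨⟨zInf, hfeas, rfl⟩, ?_⟩
      rintro _ ⟨q, hq, rfl⟩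
      exact hLP.2 q hq
    exact ⟨hLP, hleast.csInf_eq.symm⟩
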